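/- Let $G$ be a matrix Lie group, i.e. a closed subgroup of $GL(d,\mathbb{R})$, with Lie algebra $\mathfrak{g}=\{X\in\mathbb{R}^{d\times d} : e^{tX}\in G \text{ for all } t\in\mathbb{R}\}$, and assume that the exponential map $\mathfrak{g}\to G$ is surjective. For $X\in\mathfrak{g}$ let $\mathrm{ad}_X Y=[X,Y]$ and $J_{\mathfrak{g}}(X)=\int_0^1 e^{-s\,\mathrm{ad}_X}\,\mathrm{d}s$, a linear endomorphism of $\mathfrak{g}$. Let $f$ be a smooth vector field on $G$, regarded as a smooth matrix-valued function on $G$ with $f(g)\in T_gG=g\,\mathfrak{g}$ for all $g\in G$. Call $f$ group-affine if $$f(g_1g_2)=f(g_1)g_2+g_1f(g_2)-g_1f(I)g_2\qquad\text{for all } g_1,g_2\in G.$$ (1) $f$ is group-affine if and only if there exist a derivation $D:\mathfrak{g}\to\mathfrak{g}$ (a linear map with $D[X,Y]=[DX,Y]+[X,DY]$) and elements $Y_1,Y_2\in\mathfrak{g}$ such that $$f(e^X)=e^XJ_{\mathfrak{g}}(X)DX+e^XY_1+Y_2e^X\qquad\text{for all } X\in\mathfrak{g}.$$ (2) Let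 $f$ be group-affine and let $D,Y_1,Y_2$ be any such data. Then for all $X\in\mathfrak{g}$ $$e^{-X}f(e^X)-f(I)=J_{\mathfrak{g}}(X)\,(D+\mathrm{ad}_{Y_2})X,$$ so that, wherever $J_{\mathfrak{g}}(X)$ is invertible, the tangent-space equation $\dot X=J_{\mathfrak{g}}(X)^{-1}\bigl(e^{-X}f(e^X)-f(I)\bigr)$ is the linear equation $\dot X=(D+\mathrm{ad}_{Y_2})X$. Moreover, let $T\subseteq[0,\infty)$ be an interval containing $0$, let $\mu:T\to G$ solve $\dot\mu=f(\mu)$, and let $g:T\to G$ and $X:T\to\mathfrak{g}$ be paths. (a) If $X$ is differentiable, $g(t)=e^{X(t)}\mu(t)$ and $J_{\mathfrak{g}}(X(t))$ is invertible for all $t\in T$, then $g$ solves $\dot g=f(g)$ if and only if $X$ solves $\dot X=(D+\mathrm{ad}_{Y_2})X$. (b) If $X$ solves $\dot X=(D+\mathrm{ad}_{Y_2})X$ and $g(0)=e^{X(0)}\mu(0)$, then $g$ solves $\dot g=f(g)$ if and only if $g(t)=e^{X(t)}\mu(t)$ for all $t\in T$. -/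

import Mathlib

open NormedSpace Filter Topology
open scoped Matrix MatrixGroups Matrix.Norms.Operator ContDiff

attribute [local instance 100] LieRing.ofAssociativeRing

/-- A matrix Lie group: a closed subgroup of `GL(d)`. -/
abbrev MatrixLieGroup (d : ℕ) := ClosedSubgroup (GL (Fin d) ℝ)

/-- The matrix exponential, with values in the general linear group. -/
noncomputable def expGL {d : ℕ} (X : Matrix (Fin d) (Fin d) ℝ) : GL (Fin d) ℝ where
  val := exp X
  inv := exp (-X)
  val_inv := by
    rw [← Matrix.exp_add_of_commute X (-X) ((Commute.refl X).neg_right), add_neg_cancel, exp_zero]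
  inv_val := by
    rw [← Matrix.exp_add_of_commute (-X) X ((Commute.refl X).neg_left), neg_add_cancel, exp_zero]

section Helpers

variable {d : ℕ}

theorem expGL_zero : expGL (0 : Matrix (Fin d) (Fin d) ℝ) = 1 :=
  Units.ext exp_zero

theorem continuous_expGL :
    Continuous (expGL : Matrix (Fin d) (Fin d) ℝ → GL (Fin d) ℝ) := by
  rw [Units.continuous_iff]
  exact ⟨exp_continuous, exp_continuous.comp continuous_neg⟩

theorem expGL_nsmul (n : ℕ) (X : Matrix (Fin d) (Fin d) ℝ) :
    expGL (n • X) = expGL X ^ n :=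
  Units.ext (by simpa [expGL] using Matrix.exp_nsmul n X)

theorem expGL_mem_of_curve (G : MatrixLieGroup d) (c : ℝ → GL (Fin d) ℝ) (hc : ∀ t, c t ∈ G)
    (c0 : c 0 = 1) (Z : Matrix (Fin d) (Fin d) ℝ)
    (hd : HasDerivAt (fun t => (c t : Matrix (Fin d) (Fin d) ℝ)) Z 0) : expGL Z ∈ G := by
  have hs : HasStrictFDerivAt (exp : Matrix (Fin d) (Fin d) ℝ → _)
      ((ContinuousLinearEquiv.refl ℝ (Matrix (Fin d) (Fin d) ℝ) :
        Matrix (Fin d) (Fin d) ℝ →L[ℝ] Matrix (Fin d) (Fin d) ℝ)) 0 :=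
    hasStrictFDerivAt_exp_zero
  set L := hs.localInverse with hL
  have hL1 : HasFDerivAt L
      ((ContinuousLinearEquiv.refl ℝ (Matrix (Fin d) (Fin d) ℝ)).symm :
        Matrix (Fin d) (Fin d) ℝ →L[ℝ] Matrix (Fin d) (Fin d) ℝ)
      ((c 0 : GL (Fin d) ℝ) : Matrix (Fin d) (Fin d) ℝ) := by
    have := hs.to_localInverse.hasFDerivAt
    rw [exp_zero] at this
    rw [c0]; exact this
  have hl : HasDerivAt (fun t => L (c t : Matrix (Fin d) (Fin d) ℝ)) Z 0 := by
    exact hL1.comp_hasDerivAt (0 : ℝ) hd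
  have hl0 : L ((c 0 : GL (Fin d) ℝ) : Matrix (Fin d) (Fin d) ℝ) = 0 := by
    have := hs.localInverse_apply_image
    rw [exp_zero] at this
    rw [c0]; exact this
  have hev : ∀ᶠ t in 𝓝 (0 : ℝ), expGL (L (c t : Matrix (Fin d) (Fin d) ℝ)) = c t := by
    have h1 := hs.eventually_right_inverse
    rw [exp_zero] at h1
    have h2 : Tendsto (fun t => (c t : Matrix (Fin d) (Fin d) ℝ)) (𝓝 0) (𝓝 1) := by
      have := hd.continuousAt.tendsto
      rwa [c0] at this
    filter_upwards [h2.eventually h1] with t ht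
    exact Units.ext ht
  have hn : Tendsto (fun n : ℕ => ((n : ℝ) + 1)⁻¹) atTop (𝓝[≠] 0) := by
    refine tendsto_nhdsWithin_iff.2 ⟨?_, Eventually.of_forall fun n => ?_⟩
    · simpa using tendsto_one_div_add_atTop_nhds_zero_nat (𝕜 := ℝ)
    · have : (0 : ℝ) < (n : ℝ) + 1 := by positivity
      exact (inv_pos.2 this).ne'
  have hlim : Tendsto (fun n : ℕ =>
      (n + 1) • L (c ((n : ℝ) + 1)⁻¹ : Matrix (Fin d) (Fin d) ℝ)) atTop (𝓝 Z) := by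
    have := (hasDerivAt_iff_tendsto_slope.1 hl).comp hn
    refine this.congr fun n => ?_
    simp only [Function.comp, slope, hl0, vsub_eq_sub, sub_zero, inv_inv]
    rw [← Nat.cast_smul_eq_nsmul ℝ]; push_cast; rfl
  have hG : IsClosed (G : Set (GL (Fin d) ℝ)) := G.isClosed'
  refine hG.mem_of_tendsto ((continuous_expGL.tendsto Z).comp hlim) ?_
  filter_upwards [(hn.mono_right nhdsWithin_le_nhds).eventually hev] with n hn
  show expGL _ ∈ G
  rw [expGL_nsmul, hn]
  exact pow_mem (hc _) _

theorem hasDerivAt_expGL_smul (X : Matrix (Fin d) (Fin d) ℝ) :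
    HasDerivAt (fun t : ℝ => (expGL (t • X) : Matrix (Fin d) (Fin d) ℝ)) X 0 := by
  have := hasDerivAt_exp_smul_const (𝕂 := ℝ) X (0 : ℝ)
  rw [zero_smul, exp_zero, one_mul] at this
  exact this

theorem expGL_smul_add_mem (G : MatrixLieGroup d) {X Y : Matrix (Fin d) (Fin d) ℝ}
    (hX : ∀ t : ℝ, expGL (t • X) ∈ G) (hY : ∀ t : ℝ, expGL (t • Y) ∈ G) (t : ℝ) :
    expGL (t • (X + Y)) ∈ G := by
  refine expGL_mem_of_curve G (fun s => expGL (s • (t • X)) * expGL (s • (t • Y)))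
    (fun s => mul_mem ?_ ?_) ?_ _ ?_
  · rw [smul_smul]; exact hX _
  · rw [smul_smul]; exact hY _
  · simp [expGL_zero]
  · have := (hasDerivAt_expGL_smul (t • X)).mul (hasDerivAt_expGL_smul (t • Y))
    simp only [zero_smul, expGL_zero, Units.val_one, mul_one, one_mul, ← smul_add] at this
    exact this

end Helpers

namespace MatrixLieGroup

variable {d : ℕ}

/-- The tangent vectors of the one-parameter subgroups of `G`, as a linear subspace. -/
def lieSubmodule (G : MatrixLieGroup d) : Submodule ℝ (Matrix (Fin d) (Fin d) ℝ) where
  carrier := {X | ∀ t : ℝ, expGL (t • X) ∈ G}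
  add_mem' hX hY := expGL_smul_add_mem G hX hY
  zero_mem' t := by rw [smul_zero, expGL_zero]; exact one_mem G
  smul_mem' c X hX t := by rw [smul_smul]; exact hX _

theorem conj_mem_lieSubmodule (G : MatrixLieGroup d) {g : GL (Fin d) ℝ} (hg : g ∈ G)
    {X : Matrix (Fin d) (Fin d) ℝ} (hX : X ∈ lieSubmodule G) :
    (g : Matrix (Fin d) (Fin d) ℝ) * X * ((g⁻¹ : GL (Fin d) ℝ) : Matrix (Fin d) (Fin d) ℝ)
      ∈ lieSubmodule G := by
  intro t
  have h : expGL (t • ((g : Matrix (Fin d) (Fin d) ℝ) * X *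
      ((g⁻¹ : GL (Fin d) ℝ) : Matrix (Fin d) (Fin d) ℝ))) = g * expGL (t • X) * g⁻¹ := by
    refine Units.ext ?_
    have := Matrix.exp_units_conj g (t • X)
    simpa [expGL] using this
  rw [h]
  exact mul_mem (mul_mem hg (hX t)) (inv_mem hg)

/-- The Lie algebra `{X | e^{tX} ∈ G for all t}` of a matrix Lie group, as a Lie subalgebra of the
matrices with the commutator bracket. -/
def lieSubalgebra (G : MatrixLieGroup d) : LieSubalgebra ℝ (Matrix (Fin d) (Fin d) ℝ) where
  toSubmodule := lieSubmodule G
  lie_mem' := by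
    intro X Y hX hY
    have hc : IsClosed (lieSubmodule G : Set (Matrix (Fin d) (Fin d) ℝ)) :=
      Submodule.closed_of_finiteDimensional _
    have hd : HasDerivAt (fun t : ℝ => (expGL (t • X) : Matrix (Fin d) (Fin d) ℝ) * Y *
        (expGL (t • (-X)) : Matrix (Fin d) (Fin d) ℝ)) ⁅X, Y⁆ 0 := by
      have := ((hasDerivAt_expGL_smul X).mul_const Y).mul (hasDerivAt_expGL_smul (-X))
      simp only [zero_smul, expGL_zero, Units.val_one, mul_one, one_mul, mul_neg,
        ← sub_eq_add_neg] at this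
      exact this
    refine hc.mem_of_tendsto (hasDerivAt_iff_tendsto_slope.1 hd) (Eventually.of_forall fun t => ?_)
    have hmem : ∀ t : ℝ, (expGL (t • X) : Matrix (Fin d) (Fin d) ℝ) * Y *
        (expGL (t • (-X)) : Matrix (Fin d) (Fin d) ℝ) ∈ lieSubmodule G := by
      intro t
      have h := conj_mem_lieSubmodule G (hX t) hY
      have hi : (expGL (t • X))⁻¹ = expGL (t • (-X)) := by
        refine Units.ext ?_
        change exp (-(t • X)) = exp (t • (-X))
        rw [smul_neg]
      rwa [hi] at h
    exact (lieSubmodule G).smul_mem _ ((lieSubmodule G).sub_mem (hmem t) (hmem 0))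

/-- The Lie algebra `𝔤` of `G`, as a type of its own. -/
def LieAlg (G : MatrixLieGroup d) : Type := lieSubalgebra G

instance (G : MatrixLieGroup d) : LieRing (LieAlg G) :=
  inferInstanceAs (LieRing (lieSubalgebra G))

instance (G : MatrixLieGroup d) : LieAlgebra ℝ (LieAlg G) :=
  inferInstanceAs (LieAlgebra ℝ (lieSubalgebra G))

/-- The inclusion of `𝔤` in the space of all `d × d` matrices. -/
def incl (G : MatrixLieGroup d) : LieAlg G →ₗ[ℝ] Matrix (Fin d) (Fin d) ℝ :=
  (lieSubalgebra G).toSubmodule.subtype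

instance (G : MatrixLieGroup d) : CoeOut (LieAlg G) (Matrix (Fin d) (Fin d) ℝ) :=
  ⟨fun X => incl G X⟩

noncomputable instance (G : MatrixLieGroup d) : NormedAddCommGroup (LieAlg G) :=
  NormedAddCommGroup.induced _ _ (incl G) Subtype.val_injective

noncomputable instance (G : MatrixLieGroup d) : NormedSpace ℝ (LieAlg G) :=
  NormedSpace.induced _ _ _ (incl G)

instance (G : MatrixLieGroup d) : FiniteDimensional ℝ (LieAlg G) :=
  inferInstanceAs (FiniteDimensional ℝ (lieSubalgebra G).toSubmodule)

/-- The exponential map `𝔤 → G`. -/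
noncomputable def expMap (G : MatrixLieGroup d) (X : LieAlg G) : G :=
  ⟨expGL (X : Matrix (Fin d) (Fin d) ℝ), by
    have h : expGL ((1 : ℝ) • (incl G X)) ∈ G := X.2 1
    rwa [one_smul] at h⟩

/-- The inclusion of `G` in the space of all `d × d` matrices. -/
def toMat (G : MatrixLieGroup d) (g : G) : Matrix (Fin d) (Fin d) ℝ :=
  ((g : GL (Fin d) ℝ) : Matrix (Fin d) (Fin d) ℝ)

/-- `ad_X` as a continuous linear endomorphism of `𝔤`. -/
noncomputable def adL (G : MatrixLieGroup d) (X : LieAlg G) : LieAlg G →L[ℝ] LieAlg G :=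
  LinearMap.toContinuousLinearMap (LieAlgebra.ad ℝ (LieAlg G) X)

/-- The Jacobian of the exponential map, `J(X) = ∫₀¹ e^{-s ad_X} ds`. -/
noncomputable def jac (G : MatrixLieGroup d) (X : LieAlg G) : LieAlg G →L[ℝ] LieAlg G :=
  ∫ s in (0 : ℝ)..1, exp (-(s • adL G X))

end MatrixLieGroup

open MatrixLieGroup

/-- A smooth vector field on `G`, viewed as a matrix-valued function: its value at `g` lies in
the tangent space `T_g G = g 𝔤`, and it is smooth on `G` in the sense that it is locally the
restriction of a smooth function of matrices. -/
structure SmoothVectorField {d : ℕ} (G : MatrixLieGroup d) where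
  toFun : G → Matrix (Fin d) (Fin d) ℝ
  tangent : ∀ g : G, toMat G g⁻¹ * toFun g ∈ lieSubalgebra G
  smooth : ∀ g : G, ∃ U : Set (Matrix (Fin d) (Fin d) ℝ), IsOpen U ∧ toMat G g ∈ U ∧
    ∃ F : Matrix (Fin d) (Fin d) ℝ → Matrix (Fin d) (Fin d) ℝ,
      ContDiffOn ℝ ∞ F U ∧ ∀ h : G, toMat G h ∈ U → toFun h = F (toMat G h)

namespace SmoothVectorField

variable {d : ℕ} {G : MatrixLieGroup d}

instance : CoeFun (SmoothVectorField G) (fun _ => G → Matrix (Fin d) (Fin d) ℝ) := ⟨toFun⟩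

/-- `g⁻¹ f(g)`, as an element of the Lie algebra. -/
def leftTriv (f : SmoothVectorField G) (g : G) : LieAlg G :=
  ⟨toMat G g⁻¹ * f g, f.tangent g⟩

/-- `f(g₁ g₂) = f(g₁) g₂ + g₁ f(g₂) - g₁ f(I) g₂`. -/
def IsGroupAffine (f : SmoothVectorField G) : Prop :=
  ∀ g₁ g₂ : G, f (g₁ * g₂) =
    f g₁ * toMat G g₂ + toMat G g₁ * f g₂ - toMat G g₁ * f 1 * toMat G g₂

/-- `f(e^X) = e^X J(X) D X + e^X Y₁ + Y₂ e^X` for all `X ∈ 𝔤`. -/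
def HasForm (f : SmoothVectorField G) (D : LieDerivation ℝ (LieAlg G) (LieAlg G))
    (Y₁ Y₂ : LieAlg G) : Prop :=
  ∀ X : LieAlg G, f (expMap G X) =
    toMat G (expMap G X) * (jac G X (D X) : Matrix (Fin d) (Fin d) ℝ) +
      toMat G (expMap G X) * (Y₁ : Matrix (Fin d) (Fin d) ℝ) +
      (Y₂ : Matrix (Fin d) (Fin d) ℝ) * toMat G (expMap G X)

/-- `γ` solves `γ' = f(γ)` on the time interval `T`. -/
def IsSolutionOn (f : SmoothVectorField G) (γ : ℝ → G) (T : Set ℝ) : Prop :=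
  ∀ t ∈ T, HasDerivWithinAt (fun s => toMat G (γ s)) (f (γ t)) T t

end SmoothVectorField

/-- `X` solves the linear equation `X' = (D + ad_Y) X` on `T`. -/
def IsLinearSolutionOn {d : ℕ} {G : MatrixLieGroup d}
    (D : LieDerivation ℝ (LieAlg G) (LieAlg G)) (Y : LieAlg G)
    (X : ℝ → LieAlg G) (T : Set ℝ) : Prop :=
  ∀ t ∈ T, HasDerivWithinAt X (D (X t) + ⁅Y, X t⁆) T t

/-! ### The derivative of the exponential in a Banach algebra. -/

section ExpDerivative

variable {𝔸 : Type*} [NormedRing 𝔸] [NormedAlgebra ℝ 𝔸] [CompleteSpace 𝔸]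

/-! Subtracting `g Y₁ + Y₂ g` from `f` turns the group-affine identity, once `f(I) = Y₁ + Y₂`, into
the Leibniz rule `h(g₁ g₂) = h(g₁) g₂ + g₁ h(g₂)`. Part (1) thus says that the Leibniz rule is
equivalent to `h(e^X) = e^X J(X) D X` for a derivation `D`.

From Leibniz to the form (`exists_lieDerivation_of_isLeibniz`): `D` is the derivative of `h` at `I`.
Differentiating the rule on conjugates `g e^{sY} g⁻¹`, and then along `g = e^{sX}`, shows that `D`
is a derivation. On `e^{sX}` the rule gives a linear ODE for `h`, which variation of constants
solves.

From the form to Leibniz (`map_mul_expMap_of_form`): `e^{tD}` is an automorphism of `𝔤`, and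
`h(e^Z)` is the derivative of `exp (e^{tD} Z)` at `t = 0`. By symmetry of the second derivative of
`exp`, together with `J(e^{tD} Z) e^{tD} = e^{tD} J(Z)`, the derivative of `h` at `g = e^Z` along `g
Y` is `h(g) Y + g D Y` for every `Y` in the range of `J(Z)`. Where `J(Z)` is singular, replace `Z`
by `t Z`: `J(t Z)` is invertible for `t ≠ 1` near `1`, and the formula passes to the limit.
Integrating it along `g e^{sX}` yields the Leibniz rule. Surjectivity of `exp` is needed only in
this direction.

Part (2) rests on `J(X) [Y, X] = e^{-X} Y e^X - Y`, which merges the `Y₂` term with `D`. The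
group-affine identity then gives `f(e^X m) = e^X J(X)(D + ad_{Y₂})X m + e^X f(m)`, to be compared
with the product rule for `e^X μ`. The converse in (b) is uniqueness of solutions. -/

theorem continuous_exp_real : Continuous (exp : 𝔸 → 𝔸) :=
  continuous_iff_continuousAt.2 fun x => (exp_analytic (𝕂 := ℝ) x).continuousAt

theorem contDiff_exp_real : ContDiff ℝ ω (exp : 𝔸 → 𝔸) :=
  contDiff_iff_contDiffAt.2 fun x => (exp_analytic (𝕂 := ℝ) x).contDiffAt

theorem hasDerivAt_exp_smul (X : 𝔸) (t : ℝ) :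
    HasDerivAt (fun s : ℝ => exp (s • X)) (exp (t • X) * X) t :=
  hasDerivAt_exp_smul_const (𝕂 := ℝ) X t

theorem hasDerivAt_exp_smul' (X : 𝔸) (t : ℝ) :
    HasDerivAt (fun s : ℝ => exp (s • X)) (X * exp (t • X)) t :=
  hasDerivAt_exp_smul_const' (𝕂 := ℝ) X t

theorem hasDerivAt_exp_neg_smul (X : 𝔸) (t : ℝ) :
    HasDerivAt (fun s : ℝ => exp (-(s • X))) (-(exp (-(t • X)) * X)) t := by
  simpa [smul_neg] using hasDerivAt_exp_smul (-X) t

theorem hasDerivAt_exp_neg_smul' (X : 𝔸) (t : ℝ) :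
    HasDerivAt (fun s : ℝ => exp (-(s • X))) (-(X * exp (-(t • X)))) t := by
  simpa [smul_neg] using hasDerivAt_exp_smul' (-X) t

theorem exp_mul_exp_neg_real (X : 𝔸) : exp X * exp (-X) = 1 := by
  let _ := NormedAlgebra.restrictScalars ℚ ℝ 𝔸
  rw [← exp_add_of_commute ((Commute.refl X).neg_right), add_neg_cancel, exp_zero]

theorem exp_neg_mul_exp_real (X : 𝔸) : exp (-X) * exp X = 1 := by
  simpa using exp_mul_exp_neg_real (-X)

/-- The left-trivialized derivative of the exponential at `Z` in the direction `W`. -/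
noncomputable def expJac (Z W : 𝔸) : 𝔸 :=
  ∫ τ in (0 : ℝ)..1, exp (-(τ • Z)) * W * exp (τ • Z)

/-- Duhamel's formula: integrate the derivative of `e^{-τZ} e^{τ(Z+sW)}` over `[0, 1]`. Since it is
exact for every `s`, differentiating at `s = 0` only requires continuity of the integral in `s`. -/
theorem exp_neg_mul_exp_add_smul (Z W : 𝔸) (s : ℝ) :
    exp (-Z) * exp (Z + s • W) - 1 =
      s • ∫ τ in (0 : ℝ)..1, exp (-(τ • Z)) * W * exp (τ • (Z + s • W)) := by
  have hd : ∀ τ : ℝ, HasDerivAt (fun τ : ℝ => exp (-(τ • Z)) * exp (τ • (Z + s • W)))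
      (s • (exp (-(τ • Z)) * W * exp (τ • (Z + s • W)))) τ := fun τ => by
    refine ((hasDerivAt_exp_neg_smul Z τ).mul
      (hasDerivAt_exp_smul' (Z + s • W) τ)).congr_deriv ?_
    simp only [mul_add, add_mul, mul_smul_comm, smul_mul_assoc, neg_mul, mul_assoc]
    abel
  have hc : Continuous fun τ : ℝ => s • (exp (-(τ • Z)) * W * exp (τ • (Z + s • W))) := by
    have := continuous_exp_real (𝔸 := 𝔸)
    fun_prop
  have := intervalIntegral.integral_eq_sub_of_hasDerivAt (a := 0) (b := 1)
    (fun τ _ => hd τ) (hc.intervalIntegrable _ _)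
  rw [intervalIntegral.integral_smul] at this
  simp only [one_smul, zero_smul, neg_zero, exp_zero, mul_one] at this
  exact this.symm

theorem hasDerivAt_exp_add_smul (Z W : 𝔸) :
    HasDerivAt (fun s : ℝ => exp (Z + s • W)) (exp Z * expJac Z W) 0 := by
  have h : ∀ s : ℝ, exp (Z + s • W) = exp Z +
      s • (exp Z * ∫ τ in (0 : ℝ)..1, exp (-(τ • Z)) * W * exp (τ • (Z + s • W))) := fun s => by
    rw [← mul_smul_comm, ← exp_neg_mul_exp_add_smul, mul_sub, ← mul_assoc, exp_mul_exp_neg_real]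
    simp
  have hc : Continuous fun s : ℝ =>
      exp Z * ∫ τ in (0 : ℝ)..1, exp (-(τ • Z)) * W * exp (τ • (Z + s • W)) := by
    refine continuous_const.mul
      (intervalIntegral.continuous_parametric_intervalIntegral_of_continuous' ?_ _ _)
    have := continuous_exp_real (𝔸 := 𝔸)
    fun_prop
  rw [hasDerivAt_iff_tendsto_slope]
  have h0 := (hc.tendsto 0).mono_left (nhdsWithin_le_nhds (s := {(0 : ℝ)}ᶜ))
  simp only [zero_smul, add_zero] at h0
  refine h0.congr' ?_
  filter_upwards [self_mem_nhdsWithin] with s hs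
  rw [slope_def_module, h s, h 0]
  simp only [zero_smul, add_zero, sub_zero, add_sub_cancel_left, smul_smul]
  rw [inv_mul_cancel₀ hs, one_smul]

theorem fderiv_exp_apply (Z W : 𝔸) : fderiv ℝ exp Z W = exp Z * expJac Z W := by
  have h1 : HasFDerivAt exp (fderiv ℝ exp Z) (Z + (0 : ℝ) • W) := by
    rw [zero_smul, add_zero]
    exact (exp_analytic (𝕂 := ℝ) Z).differentiableAt.hasFDerivAt
  have h2 : HasDerivAt (fun s : ℝ => Z + s • W) W 0 := by
    simpa using ((hasDerivAt_id (0 : ℝ)).smul_const W).const_add Z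
  exact (h1.comp_hasDerivAt (0 : ℝ) h2).unique (hasDerivAt_exp_add_smul Z W)

theorem hasFDerivAt_exp_fderiv (Z : 𝔸) : HasFDerivAt exp (fderiv ℝ exp Z) Z :=
  (exp_analytic (𝕂 := ℝ) Z).differentiableAt.hasFDerivAt

/-- The left-trivialized derivative of the exponential, as a continuous linear map. -/
noncomputable def expJacL (Z : 𝔸) : 𝔸 →L[ℝ] 𝔸 :=
  (ContinuousLinearMap.mul ℝ 𝔸 (exp (-Z))).comp (fderiv ℝ exp Z)

theorem expJacL_apply (Z W : 𝔸) : expJacL Z W = expJac Z W := by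
  simp [expJacL, fderiv_exp_apply, ← mul_assoc, exp_neg_mul_exp_real]

theorem expJacL_zero : expJacL (0 : 𝔸) = 1 := by
  ext W
  simp [expJacL_apply, expJac]

theorem contDiff_expJacL : ContDiff ℝ ω (expJacL : 𝔸 → 𝔸 →L[ℝ] 𝔸) := by
  have h1 : ContDiff ℝ ω (fderiv ℝ (exp : 𝔸 → 𝔸)) :=
    contDiff_exp_real.fderiv_right (m := ω) (by simp)
  have h2 : ContDiff ℝ ω fun Z : 𝔸 => ContinuousLinearMap.mul ℝ 𝔸 (exp (-Z)) :=
    (ContinuousLinearMap.mul ℝ 𝔸).contDiff.comp (contDiff_exp_real.comp contDiff_neg)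
  exact h2.clm_comp h1

/-- The determinant of `expJacL (t • Z)` is analytic in `t` and equals `1` at `t = 0`, so its zeros
are isolated. -/
theorem eventually_injective_expJacL [FiniteDimensional ℝ 𝔸] (Z : 𝔸) (t₀ : ℝ) :
    ∀ᶠ t in 𝓝[≠] t₀, Function.Injective (expJacL (t • Z)) := by
  let b := Module.finBasis ℝ 𝔸
  let Φ : (𝔸 →L[ℝ] 𝔸) →L[ℝ] Matrix (Fin (Module.finrank ℝ 𝔸)) (Fin (Module.finrank ℝ 𝔸)) ℝ :=
    LinearMap.toContinuousLinearMap
      ((LinearMap.toMatrix b b).toLinearMap ∘ₗ ContinuousLinearMap.coeLM ℝ)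
  have hΦ : ∀ A : 𝔸 →L[ℝ] 𝔸, (Φ A).det = LinearMap.det (A : 𝔸 →ₗ[ℝ] 𝔸) := fun A =>
    LinearMap.det_toMatrix b _
  let p : ℝ → ℝ := fun t => (Φ (expJacL (t • Z))).det
  have hp : ContDiff ℝ ω p := by
    have h1 : ContDiff ℝ ω fun t : ℝ => Φ (expJacL (t • Z)) :=
      Φ.contDiff.comp (contDiff_expJacL.comp (contDiff_id.smul contDiff_const))
    have h2 : ∀ i j, ContDiff ℝ ω fun t : ℝ => Φ (expJacL (t • Z)) i j := fun i j =>
      (LinearMap.toContinuousLinearMap (Matrix.entryLinearMap ℝ ℝ i j)).contDiff.comp h1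
    simp only [p, Matrix.det_apply]
    exact ContDiff.sum fun σ _ => (contDiff_prod fun i _ => h2 _ _).const_smul _
  have ha : AnalyticOnNhd ℝ p Set.univ := contDiff_omega_iff_analyticOnNhd.1 hp
  have hinj : ∀ t, p t ≠ 0 → Function.Injective (expJacL (t • Z)) := fun t ht => by
    have h : LinearMap.det (expJacL (t • Z) : 𝔸 →ₗ[ℝ] 𝔸) ≠ 0 := by rwa [← hΦ]
    exact LinearMap.ker_eq_bot.1 ((LinearMap.isUnit_iff_ker_eq_bot _).1
      ((LinearMap.isUnit_iff_isUnit_det _).2 h.isUnit))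
  rcases (ha t₀ trivial).eventually_eq_zero_or_eventually_ne_zero with h | h
  · have := ha.eqOn_zero_of_preconnected_of_eventuallyEq_zero isPreconnected_univ
      (Set.mem_univ t₀) h (Set.mem_univ 0)
    simp only [p, zero_smul, expJacL_zero, hΦ, Pi.zero_apply] at this
    exact absurd this (by simp)
  · exact h.mono hinj

/-- Conjugation by the exponential intertwines with the exponential of a commutator. -/
theorem map_exp_neg_smul_apply {E : Type*} [NormedAddCommGroup E] [NormedSpace ℝ E]
    [CompleteSpace E] (L : E →L[ℝ] 𝔸) (A : E →L[ℝ] E) (Z : 𝔸)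
    (hL : ∀ y, L (A y) = Z * L y - L y * Z) (y : E) (s : ℝ) :
    L (exp (-(s • A)) y) = exp (-(s • Z)) * L y * exp (s • Z) := by
  let v : ℝ → 𝔸 := fun s => L (exp (-(s • A)) y)
  have hv : ∀ s, HasDerivAt v (-(Z * v s - v s * Z)) s := fun s => by
    have h1 : HasDerivAt (fun s : ℝ => exp (-(s • A)) y) (-A (exp (-(s • A)) y)) s := by
      simpa using (hasDerivAt_exp_neg_smul' A s).clm_apply (hasDerivAt_const s y)
    refine (L.hasFDerivAt.comp_hasDerivAt s h1).congr_deriv ?_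
    rw [map_neg, hL]
  -- Conjugating back by `e^{sZ}` should give a constant.
  let q : ℝ → 𝔸 := fun s => exp (s • Z) * v s * exp (-(s • Z))
  have hq : ∀ s, HasDerivAt q 0 s := fun s => by
    refine (((hasDerivAt_exp_smul Z s).mul (hv s)).mul
      (hasDerivAt_exp_neg_smul' Z s)).congr_deriv ?_
    simp only [Pi.mul_apply]
    noncomm_ring
  have h0 := is_const_of_deriv_eq_zero (fun s => (hq s).differentiableAt)
    (fun s => (hq s).deriv) s 0
  have h1 : q 0 = L y := by simp [q, v]
  rw [h1] at h0
  rw [← h0]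
  simp only [q, ← mul_assoc, exp_neg_mul_exp_real, one_mul]
  simp only [mul_assoc, exp_neg_mul_exp_real, mul_one, v]

/-- With `L` the inclusion of `𝔤` and `A = ad_X`, this identifies `jac` with the Jacobian `expJac`
computed in the matrix algebra. -/
theorem map_integral_exp_neg_smul_apply {E : Type*} [NormedAddCommGroup E] [NormedSpace ℝ E]
    [CompleteSpace E] (L : E →L[ℝ] 𝔸) (A : E →L[ℝ] E) (Z : 𝔸)
    (hL : ∀ y, L (A y) = Z * L y - L y * Z) (y : E) :
    L ((∫ s in (0 : ℝ)..1, exp (-(s • A))) y) = expJac Z (L y) := by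
  have hc : Continuous fun s : ℝ => exp (-(s • A)) :=
    continuous_exp_real.comp (by fun_prop)
  have h1 := ContinuousLinearMap.intervalIntegral_comp_comm
    (L.comp (ContinuousLinearMap.apply ℝ E y))
    (hc.intervalIntegrable (μ := MeasureTheory.volume) 0 1)
  refine Eq.trans h1.symm ?_
  exact intervalIntegral.integral_congr fun s _ => map_exp_neg_smul_apply L A Z hL y s

/-- For a commutator with `Z` the integrand is the derivative of `e^{-τZ} Y e^{τZ}`. -/
theorem expJac_commutator (Z Y : 𝔸) :
    expJac Z (Y * Z - Z * Y) = exp (-Z) * Y * exp Z - Y := by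
  have hd : ∀ τ : ℝ, HasDerivAt (fun τ : ℝ => exp (-(τ • Z)) * Y * exp (τ • Z))
      (exp (-(τ • Z)) * (Y * Z - Z * Y) * exp (τ • Z)) τ := fun τ => by
    refine (((hasDerivAt_exp_neg_smul Z τ).mul_const Y).mul
      (hasDerivAt_exp_smul' Z τ)).congr_deriv ?_
    noncomm_ring
  have hc : Continuous fun τ : ℝ => exp (-(τ • Z)) * (Y * Z - Z * Y) * exp (τ • Z) := by
    have := continuous_exp_real (𝔸 := 𝔸)
    fun_prop
  have := intervalIntegral.integral_eq_sub_of_hasDerivAt (a := 0) (b := 1)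
    (fun τ _ => hd τ) (hc.intervalIntegrable _ _)
  simpa [expJac] using this

end ExpDerivative
-- The exponential of `G`, its Jacobian, and the automorphisms `e^{tD}`.
namespace MatrixLieGroup

section Exponential

variable {d : ℕ} {G : MatrixLieGroup d}

instance : CompleteSpace (LieAlg G) := FiniteDimensional.complete ℝ _

/-- The inclusion of `𝔤` in the matrices, as a continuous linear map. -/
noncomputable def inclL (G : MatrixLieGroup d) :
    LieAlg G →L[ℝ] Matrix (Fin d) (Fin d) ℝ :=
  LinearMap.toContinuousLinearMap (incl G)

theorem inclL_apply (X : LieAlg G) : inclL G X = incl G X := rfl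

theorem incl_injective : Function.Injective (incl G) := Subtype.val_injective

theorem incl_lie (X Y : LieAlg G) :
    incl G ⁅X, Y⁆ = incl G X * incl G Y - incl G Y * incl G X := rfl

theorem toMat_one : toMat G 1 = 1 := rfl

theorem toMat_mul (g h : G) : toMat G (g * h) = toMat G g * toMat G h := rfl

theorem toMat_inv_mul (g : G) : toMat G g⁻¹ * toMat G g = 1 := by
  rw [← toMat_mul, inv_mul_cancel, toMat_one]

theorem toMat_mul_inv (g : G) : toMat G g * toMat G g⁻¹ = 1 := by
  rw [← toMat_mul, mul_inv_cancel, toMat_one]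

theorem toMat_injective : Function.Injective (toMat G) :=
  fun _ _ h => Subtype.ext (Units.ext h)

theorem toMat_mul_left_cancel (g : G) {A B : Matrix (Fin d) (Fin d) ℝ}
    (h : toMat G g * A = toMat G g * B) : A = B := by
  have := congrArg (toMat G g⁻¹ * ·) h
  simpa [← mul_assoc, toMat_inv_mul] using this

theorem toMat_mul_right_cancel (g : G) {A B : Matrix (Fin d) (Fin d) ℝ}
    (h : A * toMat G g = B * toMat G g) : A = B := by
  have := congrArg (· * toMat G g⁻¹) h
  simpa [mul_assoc, toMat_mul_inv] using this

theorem toMat_expMap (X : LieAlg G) : toMat G (expMap G X) = exp (incl G X) := rfl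

theorem toMat_expMap_inv (X : LieAlg G) : toMat G (expMap G X)⁻¹ = exp (-incl G X) := rfl

theorem expMap_zero : expMap G 0 = 1 := toMat_injective (by
  rw [toMat_expMap, map_zero, exp_zero, toMat_one])

theorem expMap_neg (X : LieAlg G) : expMap G (-X) = (expMap G X)⁻¹ := toMat_injective (by
  rw [toMat_expMap, toMat_expMap_inv, map_neg])

theorem expMap_add_smul (s t : ℝ) (X : LieAlg G) :
    expMap G ((s + t) • X) = expMap G (s • X) * expMap G (t • X) := toMat_injective (by
  rw [toMat_mul, toMat_expMap, toMat_expMap, toMat_expMap, add_smul, map_add, map_smul, map_smul]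
  exact Matrix.exp_add_of_commute _ _
    (((Commute.refl (incl G X)).smul_left s).smul_right t))

theorem hasDerivAt_toMat_expMap_smul (X : LieAlg G) (t : ℝ) :
    HasDerivAt (fun s : ℝ => toMat G (expMap G (s • X)))
      (toMat G (expMap G (t • X)) * incl G X) t := by
  simp only [toMat_expMap, map_smul]
  exact hasDerivAt_exp_smul (incl G X) t

theorem incl_jac (X Y : LieAlg G) : incl G (jac G X Y) = expJac (incl G X) (incl G Y) :=
  map_integral_exp_neg_smul_apply (inclL G) (adL G X) (incl G X) (fun y => incl_lie X y) Y

theorem fderiv_exp_incl (X Y : LieAlg G) :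
    fderiv ℝ exp (incl G X) (incl G Y) = toMat G (expMap G X) * incl G (jac G X Y) := by
  rw [incl_jac, toMat_expMap]
  exact fderiv_exp_apply _ _

/-- The derivative of `e^{X(t)}` is `e^{X(t)} J(X(t)) X'(t)`. -/
theorem hasDerivWithinAt_toMat_expMap {X : ℝ → LieAlg G} {X' : LieAlg G} {T : Set ℝ} {t : ℝ}
    (hX : HasDerivWithinAt X X' T t) :
    HasDerivWithinAt (fun s => toMat G (expMap G (X s)))
      (toMat G (expMap G (X t)) * incl G (jac G (X t) X')) T t := by
  have h1 : HasDerivWithinAt (fun s => incl G (X s)) (incl G X') T t :=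
    (inclL G).hasFDerivAt.comp_hasDerivWithinAt t hX
  rw [← fderiv_exp_incl]
  exact (hasFDerivAt_exp_fderiv (incl G (X t))).comp_hasDerivWithinAt t h1

theorem expJacL_incl (X Y : LieAlg G) : expJacL (incl G X) (incl G Y) = incl G (jac G X Y) := by
  rw [expJacL_apply, incl_jac]

/-- Injectivity on all matrices restricts to `𝔤`, where finite dimension turns it into surjectivity.
-/
theorem eventually_surjective_jac (Z : LieAlg G) (t₀ : ℝ) :
    ∀ᶠ t in 𝓝[≠] t₀, Function.Surjective (jac G (t • Z)) := by
  filter_upwards [eventually_injective_expJacL (incl G Z) t₀] with t ht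
  refine LinearMap.surjective_of_injective (f := (jac G (t • Z) : LieAlg G →ₗ[ℝ] LieAlg G))
    fun Y₁ Y₂ h => incl_injective (ht ?_)
  have h' : jac G (t • Z) Y₁ = jac G (t • Z) Y₂ := h
  rw [← map_smul, expJacL_incl, expJacL_incl, h']

/-- `J(X) [Y, X] = e^{-X} Y e^X - Y`. -/
theorem incl_jac_lie (X Y : LieAlg G) :
    incl G (jac G X ⁅Y, X⁆) =
      toMat G (expMap G X)⁻¹ * incl G Y * toMat G (expMap G X) - incl G Y := by
  rw [incl_jac, incl_lie]
  exact expJac_commutator _ _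

/-- The derivation `D` as a continuous linear map. -/
noncomputable def derivL (D : LieDerivation ℝ (LieAlg G) (LieAlg G)) : LieAlg G →L[ℝ] LieAlg G :=
  LinearMap.toContinuousLinearMap (D : LieAlg G →ₗ[ℝ] LieAlg G)

theorem derivL_apply (D : LieDerivation ℝ (LieAlg G) (LieAlg G)) (X : LieAlg G) :
    derivL D X = D X := rfl

theorem derivL_lie (D : LieDerivation ℝ (LieAlg G) (LieAlg G)) (X Y : LieAlg G) :
    derivL D ⁅X, Y⁆ = ⁅derivL D X, Y⁆ + ⁅X, derivL D Y⁆ := by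
  simp only [derivL_apply, LieDerivation.apply_lie_eq_add]
  exact add_comm _ _

theorem hasDerivAt_lie {x y : ℝ → LieAlg G} {x' y' : LieAlg G} {t : ℝ}
    (hx : HasDerivAt x x' t) (hy : HasDerivAt y y' t) :
    HasDerivAt (fun s => ⁅x s, y s⁆) (⁅x', y t⁆ + ⁅x t, y'⁆) t := by
  let B : LieAlg G →L[ℝ] LieAlg G →L[ℝ] LieAlg G :=
    LinearMap.toContinuousLinearMap
      (LinearMap.toContinuousLinearMap.toLinearMap ∘ₗ
        (LieAlgebra.ad ℝ (LieAlg G) : LieAlg G →ₗ[ℝ] Module.End ℝ (LieAlg G)))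
  exact (B.hasFDerivAt.comp_hasDerivAt t hx).clm_apply hy

/-- `e^{tD}` is an automorphism of the Lie algebra. -/
theorem exp_smul_derivL_lie (D : LieDerivation ℝ (LieAlg G) (LieAlg G)) (X Y : LieAlg G) (t : ℝ) :
    exp (t • derivL D) ⁅X, Y⁆ = ⁅exp (t • derivL D) X, exp (t • derivL D) Y⁆ := by
  have hx : ∀ (X : LieAlg G) t, HasDerivAt (fun t : ℝ => exp (t • derivL D) X)
      (derivL D (exp (t • derivL D) X)) t := fun X t => by
    simpa using (hasDerivAt_exp_smul' (derivL D) t).clm_apply (hasDerivAt_const t X)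
  -- Both sides of the claim solve `y' = D y`, the bracket because `D` is a derivation; hence this
  -- quotient is constant.
  let q : ℝ → LieAlg G := fun t =>
    exp (-(t • derivL D)) ⁅exp (t • derivL D) X, exp (t • derivL D) Y⁆
  have hq : ∀ t, HasDerivAt q 0 t := fun t => by
    refine ((hasDerivAt_exp_neg_smul (derivL D) t).clm_apply
      (hasDerivAt_lie (hx X t) (hx Y t))).congr_deriv ?_
    rw [← derivL_lie]
    simp
  have h0 := is_const_of_deriv_eq_zero (fun s => (hq s).differentiableAt)
    (fun s => (hq s).deriv) t 0
  have h1 : q 0 = ⁅X, Y⁆ := by simp [q]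
  rw [h1] at h0
  rw [← h0]
  simp only [q]
  rw [← mul_apply_eq_comp, exp_mul_exp_neg_real, one_apply_eq_self]

/-- An automorphism `ψ` intertwines `ad_Z` with `ad_{ψZ}`, hence also their exponentials and the
integrals of these. -/
theorem jac_exp_smul_derivL (D : LieDerivation ℝ (LieAlg G) (LieAlg G)) (Z W : LieAlg G) (t : ℝ) :
    jac G (exp (t • derivL D) Z) (exp (t • derivL D) W) = exp (t • derivL D) (jac G Z W) := by
  set ψ : LieAlg G →L[ℝ] LieAlg G := exp (t • derivL D) with hψ
  have hs : ∀ s : ℝ, SemiconjBy ψ (exp (-(s • adL G Z))) (exp (-(s • adL G (ψ Z)))) := fun s => by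
    let _ := NormedAlgebra.restrictScalars ℚ ℝ (LieAlg G →L[ℝ] LieAlg G)
    have h : SemiconjBy ψ (adL G Z) (adL G (ψ Z)) := by
      ext Y
      exact exp_smul_derivL_lie D Z Y t
    refine SemiconjBy.exp_right (SemiconjBy.neg_right ?_)
    rw [SemiconjBy, mul_smul_comm, smul_mul_assoc, h.eq]
  have hc : ∀ Z : LieAlg G, IntervalIntegrable (fun s : ℝ => exp (-(s • adL G Z)))
      MeasureTheory.volume 0 1 := fun Z =>
    (continuous_exp_real.comp (by fun_prop)).intervalIntegrable _ _
  have h1 := ContinuousLinearMap.intervalIntegral_comp_comm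
    (ContinuousLinearMap.apply ℝ (LieAlg G) (ψ W)) (hc (ψ Z))
  have h2 := ContinuousLinearMap.intervalIntegral_comp_comm
    (ψ.comp (ContinuousLinearMap.apply ℝ (LieAlg G) W)) (hc Z)
  refine Eq.trans h1.symm (Eq.trans ?_ h2)
  exact intervalIntegral.integral_congr fun s _ => (DFunLike.congr_fun (hs s).eq W).symm

end Exponential

end MatrixLieGroup
-- Second derivative of the exponential, and linear differential equations.
section ExpSecondDerivative

variable {𝔸 : Type*} [NormedRing 𝔸] [NormedAlgebra ℝ 𝔸] [CompleteSpace 𝔸]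

theorem hasFDerivAt_fderiv_exp (Z : 𝔸) :
    HasFDerivAt (fderiv ℝ (exp : 𝔸 → 𝔸)) (fderiv ℝ (fderiv ℝ exp) Z) Z := by
  have h : ContDiff ℝ 1 (fderiv ℝ (exp : 𝔸 → 𝔸)) :=
    (contDiff_exp_real (𝔸 := 𝔸)).fderiv_right le_top
  exact (h.differentiable one_ne_zero Z).hasFDerivAt

theorem fderiv_fderiv_exp_comm (Z V W : 𝔸) :
    fderiv ℝ (fderiv ℝ exp) Z V W = fderiv ℝ (fderiv ℝ exp) Z W V :=
  second_derivative_symmetric (fun y => hasFDerivAt_exp_fderiv y) (hasFDerivAt_fderiv_exp Z) V W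

theorem hasDerivAt_fderiv_exp_apply {z w : ℝ → 𝔸} {V V' : 𝔸} {t : ℝ}
    (hz : HasDerivAt z V t) (hw : HasDerivAt w V' t) :
    HasDerivAt (fun t => fderiv ℝ exp (z t) (w t))
      (fderiv ℝ (fderiv ℝ exp) (z t) V (w t) + fderiv ℝ exp (z t) V') t :=
  ((hasFDerivAt_fderiv_exp (z t)).comp_hasDerivAt t hz).clm_apply hw

theorem hasDerivAt_add_smul {E : Type*} [NormedAddCommGroup E] [NormedSpace ℝ E] (Z W : E)
    (t : ℝ) : HasDerivAt (fun s : ℝ => Z + s • W) W t := by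
  simpa using ((hasDerivAt_id t).smul_const W).const_add Z

/-- The symmetry of the second derivative of the exponential, expressed along two curves. -/
theorem hasDerivAt_fderiv_exp_swap {z w : ℝ → 𝔸} {V V' R : 𝔸}
    (hz : HasDerivAt z V 0) (hw : HasDerivAt w V' 0)
    (hR : HasDerivAt (fun t => fderiv ℝ exp (z t) (w t)) R 0) :
    HasDerivAt (fun s : ℝ => fderiv ℝ exp (z 0 + s • w 0) (V + s • V')) R 0 := by
  have h := hasDerivAt_fderiv_exp_apply (hasDerivAt_add_smul (z 0) (w 0) 0)
    (hasDerivAt_add_smul V V' 0)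
  rw [zero_smul, zero_smul, add_zero, add_zero, fderiv_fderiv_exp_comm,
    ← hR.unique (hasDerivAt_fderiv_exp_apply hz hw)] at h
  exact h

theorem eq_mul_exp_of_hasDerivAt {δ : ℝ → 𝔸} {X : 𝔸} (h : ∀ s, HasDerivAt δ (δ s * X) s) :
    δ 1 = δ 0 * exp X := by
  have hq : ∀ s, HasDerivAt (fun s => δ s * exp (-(s • X))) 0 s := fun s => by
    refine ((h s).mul (hasDerivAt_exp_neg_smul' X s)).congr_deriv ?_
    noncomm_ring
  have h0 := is_const_of_deriv_eq_zero (fun s => (hq s).differentiableAt)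
    (fun s => (hq s).deriv) 1 0
  simp only [one_smul, zero_smul, neg_zero, exp_zero, mul_one] at h0
  rw [← h0, mul_assoc, exp_neg_mul_exp_real, mul_one]

/-- Variation of constants, with integrating factor `e^{-sX}`. -/
theorem eq_exp_mul_expJac_of_hasDerivAt {H : ℝ → 𝔸} {X V : 𝔸} (h0 : H 0 = 0)
    (h : ∀ s, HasDerivAt H (V * exp (s • X) + X * H s) s) : H 1 = exp X * expJac X V := by
  have hd : ∀ s, HasDerivAt (fun s => exp (-(s • X)) * H s)
      (exp (-(s • X)) * V * exp (s • X)) s := fun s => by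
    refine ((hasDerivAt_exp_neg_smul X s).mul (h s)).congr_deriv ?_
    noncomm_ring
  have hc : Continuous fun s : ℝ => exp (-(s • X)) * V * exp (s • X) := by
    have := continuous_exp_real (𝔸 := 𝔸)
    fun_prop
  have := intervalIntegral.integral_eq_sub_of_hasDerivAt (a := 0) (b := 1)
    (fun τ _ => hd τ) (hc.intervalIntegrable _ _)
  rw [expJac, this]
  simp [h0, ← mul_assoc, exp_mul_exp_neg_real]

theorem mem_of_hasDerivAt_of_forall_mem {E : Type*} [NormedAddCommGroup E] [NormedSpace ℝ E]
    {p : Submodule ℝ E} (hp : IsClosed (p : Set E)) {γ : ℝ → E} {v : E} {t : ℝ}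
    (hγ : ∀ s, γ s ∈ p) (h : HasDerivAt γ v t) : v ∈ p :=
  hp.mem_of_tendsto (hasDerivAt_iff_tendsto_slope.1 h)
    (Eventually.of_forall fun s => p.smul_mem _ (p.sub_mem (hγ s) (hγ t)))

end ExpSecondDerivative

/-! ### From the form `e^X J(X) D X` to the Leibniz rule. -/

namespace MatrixLieGroup

section SmoothFunctions

variable {d : ℕ} {G : MatrixLieGroup d}

/-- A function on `G` which is locally the restriction of a smooth function of matrices. -/
def IsLocallySmooth (h : G → Matrix (Fin d) (Fin d) ℝ) : Prop :=
  ∀ g : G, ∃ U : Set (Matrix (Fin d) (Fin d) ℝ), IsOpen U ∧ toMat G g ∈ U ∧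
    ∃ F : Matrix (Fin d) (Fin d) ℝ → Matrix (Fin d) (Fin d) ℝ,
      ContDiffOn ℝ ∞ F U ∧ ∀ k : G, toMat G k ∈ U → h k = F (toMat G k)

theorem IsLocallySmooth.sub_mul_sub_mul {h : G → Matrix (Fin d) (Fin d) ℝ}
    (hs : IsLocallySmooth h) (A B : Matrix (Fin d) (Fin d) ℝ) :
    IsLocallySmooth fun g => h g - toMat G g * A - B * toMat G g := by
  intro g
  obtain ⟨U, hU, hgU, F, hF, hE⟩ := hs g
  refine ⟨U, hU, hgU, fun M => F M - M * A - B * M, ?_, fun k hk => by simp only [hE k hk]⟩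
  exact (hF.sub (contDiff_id.mul contDiff_const).contDiffOn).sub
    (contDiff_const.mul contDiff_id).contDiffOn

theorem hasDerivAt_comp_of_eq {h : G → Matrix (Fin d) (Fin d) ℝ}
    {U : Set (Matrix (Fin d) (Fin d) ℝ)} (hU : IsOpen U)
    {F : Matrix (Fin d) (Fin d) ℝ → Matrix (Fin d) (Fin d) ℝ} (hF : ContDiffOn ℝ ∞ F U)
    (hE : ∀ k : G, toMat G k ∈ U → h k = F (toMat G k)) {c : ℝ → G} {t : ℝ}
    {v : Matrix (Fin d) (Fin d) ℝ} (hc : HasDerivAt (fun s => toMat G (c s)) v t)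
    (hct : toMat G (c t) ∈ U) :
    HasDerivAt (fun s => h (c s)) (fderiv ℝ F (toMat G (c t)) v) t := by
  have hFd : HasFDerivAt F (fderiv ℝ F (toMat G (c t))) (toMat G (c t)) :=
    ((hF.contDiffAt (hU.mem_nhds hct)).differentiableAt (by simp)).hasFDerivAt
  refine (hFd.comp_hasDerivAt t hc).congr_of_eventuallyEq ?_
  filter_upwards [hc.continuousAt.tendsto.eventually (hU.mem_nhds hct)] with s hs
  exact hE _ hs

theorem hasDerivAt_toMat_mul_expMap_smul (g : G) (X : LieAlg G) :
    HasDerivAt (fun s : ℝ => toMat G (g * expMap G (s • X))) (toMat G g * incl G X) 0 := by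
  have h := (hasDerivAt_toMat_expMap_smul X 0).const_mul (toMat G g)
  rw [zero_smul, expMap_zero, toMat_one, one_mul] at h
  exact h

theorem hasDerivAt_toMat_expMap {X : ℝ → LieAlg G} {X' : LieAlg G} {t : ℝ}
    (hX : HasDerivAt X X' t) :
    HasDerivAt (fun s => toMat G (expMap G (X s)))
      (toMat G (expMap G (X t)) * incl G (jac G (X t) X')) t :=
  (hasDerivWithinAt_toMat_expMap hX.hasDerivWithinAt (T := Set.univ)).hasDerivAt univ_mem

theorem hasDerivAt_toMat_expMap_add_smul (Z W : LieAlg G) :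
    HasDerivAt (fun s : ℝ => toMat G (expMap G (Z + s • W)))
      (toMat G (expMap G Z) * incl G (jac G Z W)) 0 := by
  have := hasDerivAt_toMat_expMap (hasDerivAt_add_smul Z W 0)
  rw [zero_smul, add_zero] at this
  exact this

theorem hasDerivAt_exp_smul_derivL_apply (D : LieDerivation ℝ (LieAlg G) (LieAlg G))
    (Z : LieAlg G) : HasDerivAt (fun t : ℝ => exp (t • derivL D) Z) (D Z) 0 := by
  simpa [derivL_apply] using
    (hasDerivAt_exp_smul' (derivL D) 0).clm_apply (hasDerivAt_const 0 Z)

/-- The derivative of `e^Z J(Z) D Z` in the direction `W`. -/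
theorem hasDerivAt_expMap_mul_jac_deriv (D : LieDerivation ℝ (LieAlg G) (LieAlg G))
    (Z W : LieAlg G) :
    HasDerivAt (fun s : ℝ => toMat G (expMap G (Z + s • W)) *
        incl G (jac G (Z + s • W) (D (Z + s • W))))
      (toMat G (expMap G Z) * incl G (jac G Z (D Z)) * incl G (jac G Z W) +
        toMat G (expMap G Z) * incl G (D (jac G Z W))) 0 := by
  have hz := (inclL G).hasFDerivAt.comp_hasDerivAt (0 : ℝ) (hasDerivAt_exp_smul_derivL_apply D Z)
  have hw := (inclL G).hasFDerivAt.comp_hasDerivAt (0 : ℝ) (hasDerivAt_exp_smul_derivL_apply D W)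
  have hR : HasDerivAt (fun t : ℝ => fderiv ℝ exp (incl G (exp (t • derivL D) Z))
      (incl G (exp (t • derivL D) W)))
      (toMat G (expMap G Z) * incl G (jac G Z (D Z)) * incl G (jac G Z W) +
        toMat G (expMap G Z) * incl G (D (jac G Z W))) 0 := by
    -- By equivariance of `J`, the curve equals `e^{ψZ} ψ(J(Z) W)` with `ψ = e^{tD}`, so the product
    -- rule applies.
    have h1 := hasDerivAt_toMat_expMap (hasDerivAt_exp_smul_derivL_apply D Z)
    have h2 := (inclL G).hasFDerivAt.comp_hasDerivAt (0 : ℝ)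
      (hasDerivAt_exp_smul_derivL_apply D (jac G Z W))
    have h3 := h1.mul h2
    simp only [zero_smul, exp_zero, Function.comp_apply, inclL_apply, one_apply_eq_self] at h3
    refine h3.congr_of_eventuallyEq (Eventually.of_forall fun t => ?_)
    change fderiv ℝ exp (incl G (exp (t • derivL D) Z)) (incl G (exp (t • derivL D) W)) =
      toMat G (expMap G (exp (t • derivL D) Z)) * incl G (exp (t • derivL D) (jac G Z W))
    rw [fderiv_exp_incl, jac_exp_smul_derivL]
  have := hasDerivAt_fderiv_exp_swap hz hw hR
  refine this.congr_of_eventuallyEq (Eventually.of_forall fun s => ?_)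
  have e0 : ∀ Y : LieAlg G, exp ((0 : ℝ) • derivL D) Y = Y := fun Y => by
    rw [zero_smul, exp_zero, one_apply_eq_self]
  have e1 : incl G (exp ((0 : ℝ) • derivL D) Z) + s • incl G (exp ((0 : ℝ) • derivL D) W) =
      incl G (Z + s • W) := by rw [e0, e0, map_add, map_smul]
  have e2 : incl G (D Z) + s • incl G (D W) = incl G (D (Z + s • W)) := by
    rw [map_add, map_smul, map_add, map_smul]
  exact (fderiv_exp_incl _ _).symm.trans
    (congrArg₂ (fun A B => fderiv ℝ exp A B) e1.symm e2.symm)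

/-- The curves `e^{Z+sW}` only reach the directions `e^Z J(Z) W`, which need not fill the tangent
space. The formula is therefore proved at `e^{tZ}` for `t ≠ 1` near `1`, where `J(tZ)` is onto, and
extended to `t = 1` by continuity of the derivative of `F`. -/
theorem hasDerivAt_mul_expMap_of_form {h : G → Matrix (Fin d) (Fin d) ℝ}
    (hexp : Function.Surjective (expMap G)) (hs : IsLocallySmooth h)
    (D : LieDerivation ℝ (LieAlg G) (LieAlg G))
    (hD : ∀ X, h (expMap G X) = toMat G (expMap G X) * incl G (jac G X (D X)))
    (g : G) (X : LieAlg G) :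
    HasDerivAt (fun s : ℝ => h (g * expMap G (s • X)))
      (h g * incl G X + toMat G g * incl G (D X)) 0 := by
  obtain ⟨Z, rfl⟩ := hexp g
  obtain ⟨U, hU, hgU, F, hF, hE⟩ := hs (expMap G Z)
  let M : ℝ → Matrix (Fin d) (Fin d) ℝ := fun t => toMat G (expMap G (t • Z))
  have hM : Continuous M :=
    continuous_iff_continuousAt.2 fun t => (hasDerivAt_toMat_expMap_smul Z t).continuousAt
  have hM1 : M 1 = toMat G (expMap G Z) := by simp only [M, one_smul]
  have hMU : ∀ᶠ t in 𝓝 (1 : ℝ), M t ∈ U :=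
    hM.continuousAt.eventually (by rw [hM1]; exact hU.mem_nhds hgU)
  have key : ∀ᶠ t in 𝓝[≠] (1 : ℝ), fderiv ℝ F (M t) (M t * incl G X) =
      F (M t) * incl G X + M t * incl G (D X) := by
    filter_upwards [eventually_surjective_jac Z 1, hMU.filter_mono nhdsWithin_le_nhds]
      with t ht htU
    obtain ⟨W, rfl⟩ := ht X
    have h1 := hasDerivAt_toMat_expMap_add_smul (t • Z) W
    have h2 := hasDerivAt_comp_of_eq hU hF hE h1
      (by rw [zero_smul, add_zero]; exact htU)
    have h3 := hasDerivAt_expMap_mul_jac_deriv D (t • Z) W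
    simp only [hD, zero_smul, add_zero] at h2
    have h4 := h2.unique h3
    rw [← hD, hE _ htU] at h4
    exact h4
  have hfd : ContinuousAt (fderiv ℝ F) (M 1) :=
    (hF.continuousOn_fderiv_of_isOpen hU (by simp)).continuousAt
      (hU.mem_nhds (hM1 ▸ hgU))
  have hFc : ContinuousAt F (M 1) := hF.continuousOn.continuousAt (hU.mem_nhds (hM1 ▸ hgU))
  have hl : ContinuousAt (fun t => fderiv ℝ F (M t) (M t * incl G X)) 1 :=
    (ContinuousAt.comp (g := fderiv ℝ F) hfd hM.continuousAt).clm_apply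
      (hM.mul continuous_const).continuousAt
  have hr : ContinuousAt (fun t => F (M t) * incl G X + M t * incl G (D X)) 1 :=
    ((ContinuousAt.comp (g := F) hFc hM.continuousAt).mul continuousAt_const).add
      (hM.mul continuous_const).continuousAt
  have h1 := tendsto_nhds_unique_of_eventuallyEq (hl.tendsto.mono_left nhdsWithin_le_nhds)
    (hr.tendsto.mono_left nhdsWithin_le_nhds) key
  have h2 := hasDerivAt_comp_of_eq hU hF hE
    (hasDerivAt_toMat_mul_expMap_smul (expMap G Z) X)
    (by rw [zero_smul, expMap_zero, mul_one]; exact hgU)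
  rw [zero_smul, expMap_zero, mul_one] at h2
  rw [hM1, ← hE _ hgU] at h1
  rw [← h1]
  exact h2

/-- A smooth function of the form `e^X ↦ e^X J(X) D X` satisfies the Leibniz rule. -/
theorem map_mul_expMap_of_form {h : G → Matrix (Fin d) (Fin d) ℝ}
    (hexp : Function.Surjective (expMap G)) (hs : IsLocallySmooth h)
    (D : LieDerivation ℝ (LieAlg G) (LieAlg G))
    (hD : ∀ X, h (expMap G X) = toMat G (expMap G X) * incl G (jac G X (D X)))
    (g₁ g₂ : G) : h (g₁ * g₂) = h g₁ * toMat G g₂ + toMat G g₁ * h g₂ := by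
  obtain ⟨X, rfl⟩ := hexp g₂
  have ha : ∀ (g : G) (s : ℝ), HasDerivAt (fun s : ℝ => h (g * expMap G (s • X)))
      (h (g * expMap G (s • X)) * incl G X +
        toMat G (g * expMap G (s • X)) * incl G (D X)) s := fun g s => by
    -- Move the base point: `g e^{rX} = (g e^{sX}) e^{(r-s)X}`.
    have h1 := hasDerivAt_mul_expMap_of_form hexp hs D hD (g * expMap G (s • X)) X
    rw [← sub_self s] at h1
    refine (h1.comp_sub_const s s).congr_of_eventuallyEq (Eventually.of_forall fun r => ?_)
    dsimp only
    rw [mul_assoc, ← expMap_add_smul, add_sub_cancel]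
  -- The `D X` terms cancel in this difference, leaving `δ' = δ X`; the factor `1 *` lets `ha 1`
  -- apply as it stands.
  let δ : ℝ → Matrix (Fin d) (Fin d) ℝ := fun s =>
    h (g₁ * expMap G (s • X)) - toMat G g₁ * h (1 * expMap G (s • X))
  have hδ : ∀ s, HasDerivAt δ (δ s * incl G X) s := fun s => by
    refine ((ha g₁ s).sub ((ha 1 s).const_mul (toMat G g₁))).congr_deriv ?_
    simp only [δ, toMat_mul, toMat_one]
    noncomm_ring
  have h1 : h 1 = 0 := by
    have := hD 0
    rwa [expMap_zero, map_zero D, map_zero, map_zero, mul_zero] at this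
  have h2 : δ 1 = δ 0 * toMat G (expMap G X) := eq_mul_exp_of_hasDerivAt hδ
  simp only [δ, one_smul, zero_smul, expMap_zero, one_mul, mul_one, h1, mul_zero, sub_zero] at h2
  rw [← h2]
  abel

end SmoothFunctions

end MatrixLieGroup
-- From the Leibniz rule to a derivation.
namespace MatrixLieGroup

section Cocycles

variable {d : ℕ} {G : MatrixLieGroup d} {h : G → Matrix (Fin d) (Fin d) ℝ}

/-- The Leibniz rule `h(g₁ g₂) = h(g₁) g₂ + g₁ h(g₂)`. -/
def IsLeibniz (h : G → Matrix (Fin d) (Fin d) ℝ) : Prop :=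
  ∀ g₁ g₂ : G, h (g₁ * g₂) = h g₁ * toMat G g₂ + toMat G g₁ * h g₂

theorem IsLeibniz.map_one (hl : IsLeibniz h) : h 1 = 0 := by
  simpa [toMat_one] using hl 1 1

/-- A locally smooth function has a linear derivative along all curves through the identity. -/
theorem IsLocallySmooth.exists_derivative_one (hs : IsLocallySmooth h) :
    ∃ A : Matrix (Fin d) (Fin d) ℝ →L[ℝ] Matrix (Fin d) (Fin d) ℝ,
      ∀ (c : ℝ → G) (v : Matrix (Fin d) (Fin d) ℝ), c 0 = 1 →
        HasDerivAt (fun s => toMat G (c s)) v 0 → HasDerivAt (fun s => h (c s)) (A v) 0 := by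
  obtain ⟨U, hU, hgU, F, hF, hE⟩ := hs 1
  refine ⟨fderiv ℝ F (toMat G 1), fun c v hc0 hc => ?_⟩
  have := hasDerivAt_comp_of_eq hU hF hE hc (by rwa [hc0])
  rwa [hc0] at this

theorem hasDerivAt_toMat_expMap_smul_zero (X : LieAlg G) :
    HasDerivAt (fun s : ℝ => toMat G (expMap G (s • X))) (incl G X) 0 := by
  simpa only [one_mul, toMat_one] using hasDerivAt_toMat_mul_expMap_smul 1 X

theorem hasDerivAt_toMat_expMap_smul_inv_zero (X : LieAlg G) :
    HasDerivAt (fun s : ℝ => toMat G (expMap G (s • X))⁻¹) (-incl G X) 0 := by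
  simpa only [smul_neg, expMap_neg, map_neg] using hasDerivAt_toMat_expMap_smul_zero (-X)

theorem exists_lieDerivation_of_isLeibniz (hs : IsLocallySmooth h) (hl : IsLeibniz h)
    (ht : ∀ g, toMat G g⁻¹ * h g ∈ lieSubalgebra G) :
    ∃ D : LieDerivation ℝ (LieAlg G) (LieAlg G),
      ∀ X, h (expMap G X) = toMat G (expMap G X) * incl G (jac G X (D X)) := by
  obtain ⟨A, hA⟩ := hs.exists_derivative_one
  have hX : ∀ X : LieAlg G, HasDerivAt (fun s : ℝ => h (expMap G (s • X))) (A (incl G X)) 0 :=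
    fun X => hA _ _ (by rw [zero_smul, expMap_zero]) (hasDerivAt_toMat_expMap_smul_zero X)
  have hXi : ∀ X : LieAlg G,
      HasDerivAt (fun s : ℝ => h (expMap G (s • X))⁻¹) (-A (incl G X)) 0 := fun X => by
    rw [← map_neg]
    exact hA _ _ (by rw [zero_smul, expMap_zero, inv_one])
      (hasDerivAt_toMat_expMap_smul_inv_zero X)
  have hmem : ∀ X : LieAlg G, A (incl G X) ∈ lieSubmodule G := fun X => by
    have h1 := (hasDerivAt_toMat_expMap_smul_inv_zero X).mul (hX X)
    simp only [zero_smul, expMap_zero, inv_one, toMat_one, hl.map_one, mul_zero, one_mul,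
      zero_add] at h1
    exact mem_of_hasDerivAt_of_forall_mem (Submodule.closed_of_finiteDimensional _)
      (fun s => ht (expMap G (s • X))) h1
  -- Differentiate `h (g e^{sY} g⁻¹)` at `s = 0` in two ways: by the chain rule and by the Leibniz
  -- rule.
  have hconj : ∀ (g : G) (Y : LieAlg G),
      A (toMat G g * incl G Y * toMat G g⁻¹) = h g * incl G Y * toMat G g⁻¹ +
        toMat G g * A (incl G Y) * toMat G g⁻¹ + toMat G g * incl G Y * h g⁻¹ := fun g Y => by
    have h1 : HasDerivAt (fun s : ℝ => toMat G (g * expMap G (s • Y) * g⁻¹))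
        (toMat G g * incl G Y * toMat G g⁻¹) 0 :=
      (hasDerivAt_toMat_mul_expMap_smul g Y).mul_const (toMat G g⁻¹)
    have h2 := hA _ _ (by rw [zero_smul, expMap_zero, mul_one, mul_inv_cancel]) h1
    have h3 : HasDerivAt (fun s : ℝ => h (g * expMap G (s • Y) * g⁻¹))
        (h g * incl G Y * toMat G g⁻¹ + toMat G g * A (incl G Y) * toMat G g⁻¹ +
          toMat G g * incl G Y * h g⁻¹) 0 := by
      have e1 := ((hasDerivAt_toMat_expMap_smul_zero Y).const_mul (h g)).mul_const (toMat G g⁻¹)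
      have e2 := ((hX Y).const_mul (toMat G g)).mul_const (toMat G g⁻¹)
      have e3 := ((hasDerivAt_toMat_expMap_smul_zero Y).const_mul (toMat G g)).mul_const (h g⁻¹)
      refine ((e1.add e2).add e3).congr_of_eventuallyEq (Eventually.of_forall fun s => ?_)
      change h (g * expMap G (s • Y) * g⁻¹) = h g * toMat G (expMap G (s • Y)) * toMat G g⁻¹ +
        toMat G g * h (expMap G (s • Y)) * toMat G g⁻¹ +
        toMat G g * toMat G (expMap G (s • Y)) * h g⁻¹
      rw [hl, hl, toMat_mul, add_mul]
    exact h2.unique h3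
  -- Differentiate `hconj` along `g = e^{sX}`; the terms containing `h 1 = 0` drop out.
  have hlie : ∀ X Y : LieAlg G, A (incl G ⁅X, Y⁆) =
      (A (incl G X) * incl G Y - incl G Y * A (incl G X)) +
        (incl G X * A (incl G Y) - A (incl G Y) * incl G X) := fun X Y => by
    have m1 := hasDerivAt_toMat_expMap_smul_zero X
    have m2 := hasDerivAt_toMat_expMap_smul_inv_zero X
    have h1 := A.hasFDerivAt.comp_hasDerivAt (0 : ℝ) ((m1.mul_const (incl G Y)).mul m2)
    have h2 := ((((hX X).mul_const (incl G Y)).mul m2).add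
      ((m1.mul_const (A (incl G Y))).mul m2)).add ((m1.mul_const (incl G Y)).mul (hXi X))
    have h3 := h1.unique (h2.congr_of_eventuallyEq
      (Eventually.of_forall fun s => hconj (expMap G (s • X)) Y))
    simp only [zero_smul, expMap_zero, inv_one, toMat_one, hl.map_one, mul_one, one_mul,
      zero_mul, mul_neg, add_zero, mul_zero, neg_zero] at h3
    rw [incl_lie, sub_eq_add_neg]
    refine h3.trans ?_
    abel
  let D : LieDerivation ℝ (LieAlg G) (LieAlg G) :=
    { toFun := fun X => ⟨A (incl G X), hmem X⟩
      map_add' := fun X Y => incl_injective 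
        ((congrArg A (map_add (incl G) X Y)).trans (map_add A _ _))
      map_smul' := fun c X => incl_injective 
        ((congrArg A (map_smul (incl G) c X)).trans (map_smul A _ _))
      -- `LieDerivation` takes the rule in the form `D[X,Y] = [X, DY] - [Y, DX]`.
      leibniz' := fun X Y => incl_injective (by
        rw [map_sub (incl G), incl_lie, incl_lie]
        refine (hlie X Y).trans ?_
        change A (incl G X) * incl G Y - incl G Y * A (incl G X) +
            (incl G X * A (incl G Y) - A (incl G Y) * incl G X) =
          incl G X * A (incl G Y) - A (incl G Y) * incl G X -
            (incl G Y * A (incl G X) - A (incl G X) * incl G Y)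
        abel) }
  have hDA : ∀ X, incl G (D X) = A (incl G X) := fun X => rfl
  refine ⟨D, fun X => ?_⟩
  rw [incl_jac, hDA]
  -- Leibniz rule for `e^{rX} = e^{(r-s)X} e^{sX}`, differentiated at `r = s`.
  have hH : ∀ s : ℝ, HasDerivAt (fun s : ℝ => h (expMap G (s • X)))
      (A (incl G X) * exp (s • incl G X) + incl G X * h (expMap G (s • X))) s := fun s => by
    have e := ((hX X).mul_const (toMat G (expMap G (s • X)))).add
      ((hasDerivAt_toMat_expMap_smul_zero X).mul_const (h (expMap G (s • X))))
    rw [← sub_self s] at e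
    refine (e.comp_sub_const s s).congr_of_eventuallyEq (Eventually.of_forall fun r => ?_)
    change h (expMap G (r • X)) = h (expMap G ((r - s) • X)) * toMat G (expMap G (s • X)) +
      toMat G (expMap G ((r - s) • X)) * h (expMap G (s • X))
    rw [← hl, ← expMap_add_smul, sub_add_cancel]
  have h1 := eq_exp_mul_expJac_of_hasDerivAt (by rw [zero_smul, expMap_zero, hl.map_one]) hH
  rw [one_smul] at h1
  exact h1

end Cocycles

end MatrixLieGroup

/-! ### Group-affine vector fields and their solutions. -/

namespace SmoothVectorField

section GroupAffine

variable {d : ℕ} {G : MatrixLieGroup d} {f : SmoothVectorField G}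

theorem isLocallySmooth (f : SmoothVectorField G) : IsLocallySmooth f := f.smooth

theorem HasForm.map_one {D : LieDerivation ℝ (LieAlg G) (LieAlg G)} {Y₁ Y₂ : LieAlg G}
    (hf : f.HasForm D Y₁ Y₂) : f 1 = incl G Y₁ + incl G Y₂ := by
  have := hf 0
  simpa [expMap_zero, toMat_one] using this

theorem HasForm.isGroupAffine (hexp : Function.Surjective (expMap G))
    {D : LieDerivation ℝ (LieAlg G) (LieAlg G)} {Y₁ Y₂ : LieAlg G}
    (hf : f.HasForm D Y₁ Y₂) : f.IsGroupAffine := by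
  intro g₁ g₂
  have hl := map_mul_expMap_of_form hexp
    (f.isLocallySmooth.sub_mul_sub_mul (incl G Y₁) (incl G Y₂)) D
    (fun X => by rw [hf X]; abel) g₁ g₂
  rw [toMat_mul, sub_sub, sub_eq_iff_eq_add] at hl
  rw [hl, hf.map_one]
  noncomm_ring

theorem IsGroupAffine.exists_hasForm (hf : f.IsGroupAffine) :
    ∃ (D : LieDerivation ℝ (LieAlg G) (LieAlg G)) (Y₁ Y₂ : LieAlg G), f.HasForm D Y₁ Y₂ := by
  have hY : incl G (f.leftTriv 1) = f 1 := by
    change toMat G 1⁻¹ * f 1 = f 1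
    rw [inv_one, toMat_one, one_mul]
  -- The choice is `Y₁ = 0`, `Y₂ = f(I)`; the term with `0` matches the shape of `sub_mul_sub_mul`.
  obtain ⟨D, hD⟩ := exists_lieDerivation_of_isLeibniz
    (h := fun g => f g - toMat G g * 0 - f 1 * toMat G g)
    (f.isLocallySmooth.sub_mul_sub_mul 0 (f 1))
    (fun g₁ g₂ => by
      simp only [hf g₁ g₂, toMat_mul]
      noncomm_ring)
    (fun g => by
      have h1 := f.tangent g
      have h2 := conj_mem_lieSubmodule G (inv_mem g.2) (f.leftTriv 1).2
      have h3 : toMat G g⁻¹ * f 1 * toMat G g ∈ lieSubmodule G := by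
        rw [← hY]
        rw [inv_inv] at h2
        exact h2
      have h4 := (lieSubmodule G).sub_mem h1 h3
      rwa [mul_zero, sub_zero, mul_sub, ← mul_assoc])
  refine ⟨D, 0, f.leftTriv 1, fun X => ?_⟩
  rw [← hD X, hY, map_zero]
  abel

theorem incl_leftTriv (g : G) : incl G (f.leftTriv g) = toMat G g⁻¹ * f g := rfl

theorem HasForm.leftTriv_sub {D : LieDerivation ℝ (LieAlg G) (LieAlg G)} {Y₁ Y₂ : LieAlg G}
    (hf : f.HasForm D Y₁ Y₂) (X : LieAlg G) :
    f.leftTriv (expMap G X) - f.leftTriv 1 = jac G X (D X + ⁅Y₂, X⁆) := by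
  apply incl_injective
  rw [map_sub, incl_leftTriv, incl_leftTriv, map_add, map_add, incl_jac_lie, hf X, hf.map_one,
    inv_one, toMat_one, one_mul, mul_add, mul_add, ← mul_assoc, ← mul_assoc, toMat_inv_mul,
    one_mul, one_mul, mul_assoc]
  abel

/-- `f(e^X) = e^X (J(X) (D + ad_{Y₂}) X + f(I))`. -/
theorem HasForm.apply_expMap {D : LieDerivation ℝ (LieAlg G) (LieAlg G)} {Y₁ Y₂ : LieAlg G}
    (hf : f.HasForm D Y₁ Y₂) (X : LieAlg G) :
    f (expMap G X) = toMat G (expMap G X) * (incl G (jac G X (D X + ⁅Y₂, X⁆)) + f 1) := by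
  rw [← hf.leftTriv_sub, map_sub, incl_leftTriv, incl_leftTriv, inv_one, toMat_one, one_mul,
    sub_add_cancel, ← mul_assoc, toMat_mul_inv, one_mul]

theorem hasDerivWithinAt_toMat_expMap_mul {μ : ℝ → G} {T : Set ℝ} (hμ : f.IsSolutionOn μ T)
    {X : ℝ → LieAlg G} {X' : LieAlg G} {t : ℝ} (ht : t ∈ T) (hX : HasDerivWithinAt X X' T t) :
    HasDerivWithinAt (fun s => toMat G (expMap G (X s) * μ s))
      (toMat G (expMap G (X t)) * incl G (jac G (X t) X') * toMat G (μ t) +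
        toMat G (expMap G (X t)) * f (μ t)) T t :=
  (hasDerivWithinAt_toMat_expMap hX).mul (hμ t ht)

theorem IsGroupAffine.apply_expMap_mul (ha : f.IsGroupAffine)
    {D : LieDerivation ℝ (LieAlg G) (LieAlg G)} {Y₁ Y₂ : LieAlg G}
    (hf : f.HasForm D Y₁ Y₂) (X : LieAlg G) (m : G) :
    f (expMap G X * m) =
      toMat G (expMap G X) * incl G (jac G X (D X + ⁅Y₂, X⁆)) * toMat G m +
        toMat G (expMap G X) * f m := by
  rw [ha, hf.apply_expMap]
  noncomm_ring

theorem IsGroupAffine.isSolutionOn_expMap_mul (ha : f.IsGroupAffine)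
    {D : LieDerivation ℝ (LieAlg G) (LieAlg G)} {Y₁ Y₂ : LieAlg G}
    (hf : f.HasForm D Y₁ Y₂) {μ : ℝ → G} {T : Set ℝ} (hμ : f.IsSolutionOn μ T)
    {X : ℝ → LieAlg G} (hX : IsLinearSolutionOn D Y₂ X T) :
    f.IsSolutionOn (fun t => expMap G (X t) * μ t) T := fun t ht => by
  rw [ha.apply_expMap_mul hf]
  exact hasDerivWithinAt_toMat_expMap_mul hμ ht (hX t ht)

theorem IsSolutionOn.congr {γ₁ γ₂ : ℝ → G} {T : Set ℝ} (h : f.IsSolutionOn γ₁ T)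
    (he : ∀ t ∈ T, γ₂ t = γ₁ t) : f.IsSolutionOn γ₂ T := fun t ht => by
  rw [he t ht]
  exact (h t ht).congr (fun s hs => by rw [he s hs]) (by rw [he t ht])

/-- The set of times in `[0, t]` where the solutions agree is closed and contains `0`. It extends to
the right of each of its points before `t`, because the local extension `F` of `f` is C¹, hence
Lipschitz near the common value. -/
theorem IsSolutionOn.eq_of_eq_zero {γ₁ γ₂ : ℝ → G} {T : Set ℝ} (hT : T.OrdConnected)
    (h0 : 0 ∈ T) (hT0 : T ⊆ Set.Ici 0) (h₁ : f.IsSolutionOn γ₁ T) (h₂ : f.IsSolutionOn γ₂ T)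
    (he : γ₁ 0 = γ₂ 0) {t : ℝ} (ht : t ∈ T) : γ₁ t = γ₂ t := by
  have hIT : Set.Icc 0 t ⊆ T := hT.out h0 ht
  let a : ℝ → Matrix (Fin d) (Fin d) ℝ := fun s => toMat G (γ₁ s)
  let b : ℝ → Matrix (Fin d) (Fin d) ℝ := fun s => toMat G (γ₂ s)
  have hac : ContinuousOn a (Set.Icc 0 t) :=
    fun s hs => ((h₁ s (hIT hs)).continuousWithinAt).mono hIT
  have hbc : ContinuousOn b (Set.Icc 0 t) :=
    fun s hs => ((h₂ s (hIT hs)).continuousWithinAt).mono hIT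
  have hcl : IsClosed ({s | a s = b s} ∩ Set.Icc 0 t) := by
    rw [Set.inter_comm]
    exact (hac.prodMk hbc).preimage_isClosed_of_isClosed isClosed_Icc isClosed_diagonal
  refine toMat_injective ((hcl.Icc_subset_of_forall_mem_nhdsWithin (congrArg (toMat G) he) ?_)
    (Set.right_mem_Icc.2 (hT0 ht)))
  rintro x ⟨hx, hxt⟩
  have hx' : a x = b x := hx
  obtain ⟨U, hU, hgU, F, hF, hE⟩ := f.smooth (γ₁ x)
  obtain ⟨K, S, hS, hK⟩ := ((hF.contDiffAt (hU.mem_nhds hgU)).of_le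
    (show (1 : WithTop ℕ∞) ≤ ∞ by simp)).hasStrictFDerivAt one_ne_zero |>.exists_lipschitzOnWith
  have hV : S ∩ U ∈ 𝓝 (a x) := inter_mem hS (hU.mem_nhds hgU)
  have hle : 𝓝[≥] x ≤ 𝓝[Set.Icc 0 t] x :=
    nhdsWithin_le_of_mem (mem_of_superset (Icc_mem_nhdsGE hxt.2)
      (Set.Icc_subset_Icc_left hxt.1))
  have hxI : x ∈ Set.Icc 0 t := ⟨hxt.1, hxt.2.le⟩
  have hev : {s | a s ∈ S ∩ U ∧ b s ∈ S ∩ U ∧ s ∈ Set.Icc 0 t} ∈ 𝓝[≥] x := by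
    refine hle ?_
    filter_upwards [(hac x hxI).eventually hV, (hbc x hxI).eventually (hx' ▸ hV),
      self_mem_nhdsWithin] with s h1 h2 h3 using ⟨h1, h2, h3⟩
  obtain ⟨u, hu, hsub⟩ := mem_nhdsGE_iff_exists_Icc_subset.1 hev
  have hd : ∀ {γ : ℝ → G}, f.IsSolutionOn γ T → (∀ s ∈ Set.Icc x u, toMat G (γ s) ∈ S ∩ U) →
      ∀ s ∈ Set.Ico x u, HasDerivWithinAt (fun s => toMat G (γ s)) (F (toMat G (γ s)))
        (Set.Ici s) s := fun {γ} hγ hm s hs => by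
    rw [← hE _ (hm s (Set.Ico_subset_Icc_self hs)).2]
    refine (hγ s (hIT (hsub (Set.Ico_subset_Icc_self hs)).2.2)).mono_of_mem_nhdsWithin ?_
    exact mem_of_superset (Icc_mem_nhdsGE hs.2)
      fun r hr => hIT (hsub ⟨hs.1.trans hr.1, hr.2⟩).2.2
  have hEq : Set.EqOn a b (Set.Icc x u) :=
    ODE_solution_unique_of_mem_Icc_right (v := fun _ => F) (s := fun _ => S ∩ U)
      (fun _ _ => hK.mono Set.inter_subset_left)
      (hac.mono fun s hs => (hsub hs).2.2) (hd h₁ fun s hs => (hsub hs).1)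
      (fun s hs => (hsub (Set.Ico_subset_Icc_self hs)).1)
      (hbc.mono fun s hs => (hsub hs).2.2) (hd h₂ fun s hs => (hsub hs).2.1)
      (fun s hs => (hsub (Set.Ico_subset_Icc_self hs)).2.1) hx'
  exact mem_of_superset (Ioc_mem_nhdsGT hu) fun s hs => hEq (Set.Ioc_subset_Icc_self hs)

/-- Both expressions for the velocity of `e^X μ` contain `e^X f(μ)`; cancelling this term and then
`e^X`, `μ` and `J(X)` leaves the linear equation. -/
theorem IsGroupAffine.isLinearSolutionOn_of_isSolutionOn (ha : f.IsGroupAffine)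
    {D : LieDerivation ℝ (LieAlg G) (LieAlg G)} {Y₁ Y₂ : LieAlg G}
    (hf : f.HasForm D Y₁ Y₂) {T : Set ℝ} (hT : T.OrdConnected) {μ : ℝ → G}
    (hμ : f.IsSolutionOn μ T) {X : ℝ → LieAlg G} (hX : DifferentiableOn ℝ X T)
    (hJ : ∀ t ∈ T, IsUnit (jac G (X t)))
    (hg : f.IsSolutionOn (fun t => expMap G (X t) * μ t) T) :
    IsLinearSolutionOn D Y₂ X T := fun t ht => by
  -- On a one-point interval every derivative condition is vacuous; otherwise derivatives within `T`
  -- are unique.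
  rcases T.subsingleton_or_nontrivial with hs | hn
  · exact HasFDerivWithinAt.of_subsingleton hs
  · have hud : UniqueDiffOn ℝ T := uniqueDiffOn_convex hT.convex
      (hT.convex.nontrivial_iff_nonempty_interior.1 hn)
    have h1 := hasDerivWithinAt_toMat_expMap_mul hμ ht (hX t ht).hasDerivWithinAt
    have h2 := hg t ht
    rw [ha.apply_expMap_mul hf] at h2
    have h3 := (hud t ht).eq_deriv _ h1 h2
    have h4 := toMat_mul_right_cancel _ (add_right_cancel h3)
    have h5 := incl_injective (toMat_mul_left_cancel _ h4)
    obtain ⟨e, he⟩ := hJ t ht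
    have h6 : derivWithin X T t = D (X t) + ⁅Y₂, X t⁆ := by
      have := congrArg (e⁻¹ : (LieAlg G →L[ℝ] LieAlg G)ˣ).val h5
      rw [← he, ← mul_apply_eq_comp, ← mul_apply_eq_comp, Units.inv_mul,
        one_apply_eq_self, one_apply_eq_self] at this
      exact this
    rw [← h6]
    exact (hX t ht).hasDerivWithinAt

end GroupAffine

end SmoothVectorField

theorem theorem1 {d : ℕ} (G : MatrixLieGroup d)
    (hexp : Function.Surjective (expMap G)) (f : SmoothVectorField G) :
    -- characterization of the group-affine property
    (f.IsGroupAffine ↔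
      ∃ (D : LieDerivation ℝ (LieAlg G) (LieAlg G)) (Y₁ Y₂ : LieAlg G), f.HasForm D Y₁ Y₂) ∧
    -- the equation in the tangent space is linear
    (f.IsGroupAffine →
      ∀ (D : LieDerivation ℝ (LieAlg G) (LieAlg G)) (Y₁ Y₂ : LieAlg G), f.HasForm D Y₁ Y₂ →
        -- the right-hand sides of the two equations agree
        (∀ X : LieAlg G,
          f.leftTriv (expMap G X) - f.leftTriv 1 = jac G X (D X + ⁅Y₂, X⁆)) ∧
        (∀ X : LieAlg G, IsUnit (jac G X) →
          (jac G X).inverse (f.leftTriv (expMap G X) - f.leftTriv 1) = D X + ⁅Y₂, X⁆) ∧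
        -- consequences for solutions `g = e^X μ` on a time interval starting at `0`
        (∀ T : Set ℝ, T.OrdConnected → 0 ∈ T → T ⊆ Set.Ici 0 →
          ∀ g μ : ℝ → G, f.IsSolutionOn μ T → ∀ X : ℝ → LieAlg G,
            ((∀ t ∈ T, g t = expMap G (X t) * μ t) → DifferentiableOn ℝ X T →
              (∀ t ∈ T, IsUnit (jac G (X t))) →
                (f.IsSolutionOn g T ↔ IsLinearSolutionOn D Y₂ X T)) ∧
            (IsLinearSolutionOn D Y₂ X T → g 0 = expMap G (X 0) * μ 0 →
              (f.IsSolutionOn g T ↔ ∀ t ∈ T, g t = expMap G (X t) * μ t)))) := by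
  refine ⟨⟨fun ha => ha.exists_hasForm, fun ⟨_, _, _, hf⟩ => hf.isGroupAffine hexp⟩,
    fun ha D Y₁ Y₂ hf => ⟨hf.leftTriv_sub, fun X hX => ?_, fun T hT h0 hT0 g μ hμ X =>
      ⟨fun hg hXd hJ => ⟨fun hs => ?_, fun hX => ?_⟩,
        fun hX hg0 => ⟨fun hs t ht => ?_, fun hg => ?_⟩⟩⟩⟩
  · rw [hf.leftTriv_sub, ← ContinuousLinearMap.ringInverse_eq_inverse, ← mul_apply_eq_comp,
      Ring.inverse_mul_cancel _ hX, one_apply_eq_self]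
  · exact ha.isLinearSolutionOn_of_isSolutionOn hf hT hμ hXd hJ
      (hs.congr fun t ht => (hg t ht).symm)
  · exact (ha.isSolutionOn_expMap_mul hf hμ hX).congr hg
  · exact hs.eq_of_eq_zero hT h0 hT0 (ha.isSolutionOn_expMap_mul hf hμ hX) hg0 ht
  · exact (ha.isSolutionOn_expMap_mul hf hμ hX).congr hg
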